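/- Let $\Gamma$ and $\tilde\Gamma$ be finite graphs (loops and multiple edges allowed), with $\tilde\Gamma$ connected, and let $\varphi:\tilde\Gamma\to\Gamma$ be a free $\mathbb{Z}_3$-cover: a covering morphism of graphs (for every vertex $\tilde v$ of $\tilde\Gamma$, each oriented edge of $\Gamma$ starting at $\varphi(\tilde v)$ has exactly one lift starting at $\tilde v$), together with an action of $G=\mathbb{Z}_3$ on $\tilde\Gamma$ by graph automorphisms that leaves $\varphi$ invariant and is simply transitive on every fibre of $\varphi$. In particular $\Gamma$ is connected. For a finite graph $X$, let $\mathrm{Jac}(X)=\mathrm{Div}^0(X)/\mathrm{Prin}(X)$ be the group of integral divisors of degree $0$ on the vertices modulo the image of the Laplacian (valency matrix minus adjacency matrix). Choose a vertex $\tilde v$ above every vertex $v$ of $\Gamma$. For an oriented edge $e$ of $\Gamma$ from $u$ to $v$, let $F(e)\in G$ be the unique element that maps $\tilde v$ to the terminal vertex of the lift of $e$ starting at $\tilde u$. For a character $\rho:G\to\mathbb{C}^\times$ let $Q_\rho=Q$ be the diagonal matrix of the valencies of $\Gamma$ (a loop counts twice), and let $A_\rho$ be the matrix indexed by the vertices of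 $\Gamma$ with $$(A_\rho)_{uv}=\sum_{e}\rho(F(e)),$$ where the sum runs over all oriented edges $e$ from $u$ to $v$ (a loop contributes both of its orientations). Let $\rho_1,\rho_2$ be the two nontrivial characters of $G$. Then $\mathrm{Jac}(\tilde\Gamma)$ and $\mathrm{Jac}(\Gamma)$ are finite, and $$\frac{|\mathrm{Jac}(\tilde\Gamma)|}{3\,|\mathrm{Jac}(\Gamma)|}=\frac19\det(Q_{\rho_1}-A_{\rho_1})\det(Q_{\rho_2}-A_{\rho_2}),$$ whatever the choice of the vertices $\tilde v$. -/

import Mathlib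

/-- A graph with vertex set `V` and set of oriented edges `E`; loops and multiple edges are allowed.
`src e` is the starting vertex of the oriented edge `e`, and `inv e` is `e` with the opposite
orientation, so that an unoriented edge is a pair `{e, inv e}`. -/
structure OrientedGraph (V E : Type*) where
  src : E → V
  inv : E → E
  inv_inv : ∀ e, inv (inv e) = e
  inv_ne : ∀ e, inv e ≠ e

namespace OrientedGraph

variable {V E : Type*} (Γ : OrientedGraph V E)

/-- The terminal vertex of an oriented edge. -/
def tgt (e : E) : V := Γ.src (Γ.inv e)

/-- Any two vertices are joined by an edge path, and there is at least one vertex. -/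
def Connected : Prop :=
  Nonempty V ∧
    ∀ u v : V, Relation.ReflTransGen (fun a b => ∃ e : E, Γ.src e = a ∧ Γ.tgt e = b) u v

variable [Fintype V] [DecidableEq V] [Fintype E]

/-- The valency of a vertex: the number of oriented edges leaving it (a loop counts twice). -/
def valency (v : V) : ℕ := (Finset.univ.filter fun e : E => Γ.src e = v).card

/-- The diagonal matrix `Q` of valencies. -/
def valencyMatrix (R : Type*) [Ring R] : Matrix V V R :=
  Matrix.diagonal fun v => (Γ.valency v : R)

/-- The adjacency matrix `A`: its `(u, v)` entry is the number of oriented edges from `u` to `v`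
(so a loop at `u` contributes two to the entry `(u, u)`). -/
def adjacencyMatrix (R : Type*) [Ring R] : Matrix V V R :=
  Matrix.of fun u v => ((Finset.univ.filter fun e : E => Γ.src e = u ∧ Γ.tgt e = v).card : R)

/-- The Laplacian `Q - A`, as an endomorphism of the group of divisors `ℤ^V`. -/
def laplacian : (V → ℤ) →+ (V → ℤ) :=
  (Matrix.mulVecLin (Γ.valencyMatrix ℤ - Γ.adjacencyMatrix ℤ)).toAddMonoidHom

/-- The group of divisors of degree zero. -/
def divZero (V : Type*) [Fintype V] : AddSubgroup (V → ℤ) where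
  carrier := {D | ∑ v, D v = 0}
  zero_mem' := by simp
  add_mem' := by
    intro a b ha hb
    simp only [Set.mem_ofPred_eq] at ha hb
    simp [Finset.sum_add_distrib, ha, hb]
  neg_mem' := by
    intro a ha
    simp only [Set.mem_ofPred_eq] at ha
    simp [ha]

/-- The group of principal divisors. -/
def principal : AddSubgroup (V → ℤ) := Γ.laplacian.range

/-- The Jacobian (critical group) of a finite graph: divisors of degree zero modulo principal
divisors. -/
abbrev Jac : Type _ := divZero V ⧸ Γ.principal.addSubgroupOf (divZero V)

end OrientedGraph

/-- A free Galois cover of graphs `Γt → Γ` with group `G`: a covering morphism of graphs together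
with an action of `G` on `Γt` by graph automorphisms, for which the morphism is invariant and which
is simply transitive on the fibres. -/
structure FreeGaloisCover (G : Type*) [Group G] {Vt Et V E : Type*}
    [MulAction G Vt] [MulAction G Et]
    (Γt : OrientedGraph Vt Et) (Γ : OrientedGraph V E) where
  mapV : Vt → V
  mapE : Et → E
  map_src : ∀ e, mapV (Γt.src e) = Γ.src (mapE e)
  map_inv : ∀ e, mapE (Γt.inv e) = Γ.inv (mapE e)
  surjective : Function.Surjective mapV
  /-- local degree one: edges lift uniquely once the lift of the starting vertex is given -/
  lift_unique : ∀ (x : Vt) (e : E), Γ.src e = mapV x → ∃! f : Et, Γt.src f = x ∧ mapE f = e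
  smul_src : ∀ (g : G) (e : Et), Γt.src (g • e) = g • Γt.src e
  smul_inv : ∀ (g : G) (e : Et), Γt.inv (g • e) = g • Γt.inv e
  mapV_smul : ∀ (g : G) (x : Vt), mapV (g • x) = mapV x
  mapE_smul : ∀ (g : G) (e : Et), mapE (g • e) = mapE e
  transitiveV : ∀ x y : Vt, mapV x = mapV y → ∃ g : G, g • x = y
  transitiveE : ∀ e f : Et, mapE e = mapE f → ∃ g : G, g • e = f
  free : ∀ (g : G) (x : Vt), g • x = x → g = 1

namespace FreeGaloisCover

variable {G : Type*} [Group G] {Vt Et V E : Type*} [MulAction G Vt] [MulAction G Et]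
  {Γt : OrientedGraph Vt Et} {Γ : OrientedGraph V E}

/-- A choice of one vertex of `Γt` above every vertex of `Γ`. -/
abbrev VertexLift (φ : FreeGaloisCover G Γt Γ) : Type _ := {σ : V → Vt // ∀ v, φ.mapV (σ v) = v}

/-- Let `f` be the lift of the oriented edge `e` starting at the chosen vertex above the source of
`e`. There is a unique element of `G` that maps the chosen vertex above the target of `e` to the
terminal vertex of `f`. -/
theorem existsUnique_frobenius (φ : FreeGaloisCover G Γt Γ) (σ : φ.VertexLift) (e : E) :
    ∃! g : G, ∃ f : Et, Γt.src f = σ.1 (Γ.src e) ∧ φ.mapE f = e ∧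
      Γt.tgt f = g • σ.1 (Γ.tgt e) := by
  obtain ⟨f, ⟨hf1, hf2⟩, hf3⟩ := φ.lift_unique (σ.1 (Γ.src e)) e (σ.2 _).symm
  have h : φ.mapV (σ.1 (Γ.tgt e)) = φ.mapV (Γt.tgt f) := by
    rw [σ.2, OrientedGraph.tgt, OrientedGraph.tgt, φ.map_src, φ.map_inv, hf2]
  obtain ⟨g, hg⟩ := φ.transitiveV _ _ h
  refine ⟨g, ⟨f, hf1, hf2, hg.symm⟩, ?_⟩
  rintro g' ⟨f', h1, h2, h3⟩
  rw [hf3 f' ⟨h1, h2⟩, ← hg] at h3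
  have h4 := φ.free (g'⁻¹ * g) (σ.1 (Γ.tgt e)) (by rw [mul_smul, h3, inv_smul_smul])
  exact inv_mul_eq_one.mp h4

/-- The Frobenius element `F(e)` of an oriented edge, with respect to the chosen vertex lifts. -/
noncomputable def frobenius (φ : FreeGaloisCover G Γt Γ) (σ : φ.VertexLift) (e : E) : G :=
  (φ.existsUnique_frobenius σ e).choose

variable [Fintype V] [DecidableEq V] [Fintype E]

/-- The Artinised adjacency matrix `A_ρ` of a one-dimensional representation `ρ`: its `(u, v)` entry
is the sum of `ρ (F e)` over the oriented edges `e` from `u` to `v`. -/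
noncomputable def artinAdjacency (φ : FreeGaloisCover G Γt Γ) (σ : φ.VertexLift) (ρ : G →* ℂˣ) :
    Matrix V V ℂ :=
  Matrix.of fun u v => ∑ e ∈ Finset.univ.filter (fun e : E => Γ.src e = u ∧ Γ.tgt e = v),
    (ρ (φ.frobenius σ e) : ℂ)

/-- The Artinised Laplacian `Q_ρ - A_ρ` of a one-dimensional representation `ρ`, for which the
Artinised valency matrix `Q_ρ = Q ⊗ I_1` is `Q`. -/
noncomputable def artinLaplacian (φ : FreeGaloisCover G Γt Γ) (σ : φ.VertexLift) (ρ : G →* ℂˣ) :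
    Matrix V V ℂ :=
  Γ.valencyMatrix ℂ - φ.artinAdjacency σ ρ

end FreeGaloisCover

/-! Let `J` be the all-ones matrix, `n = |V|`, and `L`, `L̃` the Laplacians of base and cover. The
singular `L̃` is replaced by `L̃ + J`, whose determinant is computed in two ways. On a connected
graph, `det (L + c J) = c n² |Jac|` (`det_laplacianMatrix_add_const`): rank-one perturbations reduce
it to `L` with `1` added at one diagonal entry, whose cokernel is the Jacobian. On the cover, `L̃ +
J` commutes with `G`, so the characters block diagonalize it
(`det_laplacianMatrix_add_one_eq_prod`). The trivial block is `L + 3J`; a nontrivial one is `Q_ρ -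
A_ρ`, as its character values sum to zero. Hence `(3n)² |Jac Γ̃| = 3n² |Jac Γ| det(Q_ρ₁ - A_ρ₁)
det(Q_ρ₂ - A_ρ₂)`, for any vertex lifts. -/

namespace Matrix

/-! ### Rank-one perturbations, cokernels and group-invariant determinants -/

theorem det_one_add_vecMulVec {n R : Type*} [Fintype n] [DecidableEq n] [CommRing R]
    (u v : n → R) : det (1 + vecMulVec u v) = 1 + v ⬝ᵥ u := by
  rw [vecMulVec_eq Unit, det_one_add_replicateCol_mul_replicateRow]

/-- If `1` is in the left kernel of `A`, then `1 + x 1ᵀ` moves `a` to `a + (∑ a) x` in a rank-one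
perturbation `A + a bᵀ`. -/
theorem det_add_vecMulVec_left {n R : Type*} [Fintype n] [DecidableEq n] [CommRing R]
    {A : Matrix n n R} (hA : (1 : n → R) ᵥ* A = 0) (a b x : n → R) :
    (A + vecMulVec (a + (∑ i, a i) • x) b).det = (1 + ∑ i, x i) * (A + vecMulVec a b).det := by
  have h : A + vecMulVec (a + (∑ i, a i) • x) b
      = (1 + vecMulVec x 1) * (A + vecMulVec a b) := by
    rw [add_mul, one_mul, mul_add, vecMulVec_mul, hA, vecMulVec_mul_vecMulVec, vecMulVec_zero,
      zero_add, add_vecMulVec, one_dotProduct, add_assoc, smul_vecMulVec, vecMulVec_smul]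
  rw [h, det_mul, det_one_add_vecMulVec, one_dotProduct]

/-- A matrix whose rows and columns sum to zero: adding a constant `c` to all its entries gives
`c n²` times the determinant obtained by adding `1` to one diagonal entry. -/
theorem det_add_const {n R : Type*} [Fintype n] [DecidableEq n] [CommRing R]
    {A : Matrix n n R} (hl : (1 : n → R) ᵥ* A = 0) (hr : A *ᵥ (1 : n → R) = 0) (w : n) (c : R) :
    (A + of fun _ _ => c).det
      = c * (Fintype.card n : R) ^ 2 * (A + vecMulVec (Pi.single w 1) (Pi.single w 1)).det := by
  -- This replaces one factor of the rank-one term, from a constant vector to `Pi.single w 1`. It is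
  -- used for the columns and then, after transposing, for the rows; each use contributes a factor
  -- `n`.
  have key : ∀ (B : Matrix n n R) (d : R) (b : n → R), (1 : n → R) ᵥ* B = 0 →
      (B + vecMulVec (fun _ => d) b).det
        = d * (Fintype.card n : R) * (B + vecMulVec (Pi.single w 1) b).det := by
    intro B d b hB
    have h := det_add_vecMulVec_left hB (Pi.single w 1) b ((fun _ => d) - Pi.single w 1)
    simp only [Finset.sum_pi_single', Finset.mem_univ, if_true, one_smul, add_sub_cancel,
      Pi.sub_apply, Finset.sum_sub_distrib, Finset.sum_const, Finset.card_univ,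
      nsmul_eq_mul] at h
    rw [h]; ring
  have h1 : (of fun _ _ => c : Matrix n n R) = vecMulVec (fun _ => c) 1 := by
    ext; simp [vecMulVec_apply]
  rw [h1, key A c 1 hl, ← det_transpose, transpose_add, transpose_vecMulVec,
    show (1 : n → R) = fun _ => 1 from rfl, key Aᵀ 1 _ (by rw [vecMul_transpose, hr]),
    ← det_transpose, transpose_add, transpose_transpose, transpose_vecMulVec]
  ring

theorem card_quotient_range_mulVecLin {n : Type*} [Fintype n] [DecidableEq n]
    {A : Matrix n n ℤ} (hA : A.det ≠ 0) :
    Nat.card ((n → ℤ) ⧸ LinearMap.range A.mulVecLin) = A.det.natAbs := by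
  have hinj : Function.Injective A.mulVecLin := Matrix.mulVec_injective_of_det_ne_zero hA
  rw [← Submodule.natAbs_det_equiv _ (LinearEquiv.ofInjective _ hinj)]
  have : (LinearMap.range A.mulVecLin).subtype ∘ₗ
      ((LinearEquiv.ofInjective _ hinj : _ ≃ₗ[ℤ] _) : (n → ℤ) →ₗ[ℤ] _) = toLin' A := by
    ext; simp
  erw [this, LinearMap.det_toLin']

/-- Block diagonalization of a `G`-invariant matrix by the characters of `G`. -/
theorem det_of_group_invariant {G n : Type*} [Group G] [Fintype G] [DecidableEq G] [Fintype n]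
    [DecidableEq n] (B : n → n → G → ℂ) (χ : G → (G →* ℂ)) (hχ : Function.Injective χ) :
    (of fun (p q : n × G) => B p.1 q.1 (p.2⁻¹ * q.2)).det
      = ∏ i, (of fun u v => ∑ k, B u v k * χ i k).det := by
  -- The character table, invertible by Dedekind's independence of characters. It is square because
  -- the characters are indexed by `G` itself.
  set X : Matrix G G ℂ := of fun h i => χ i h with hX
  have hXu : IsUnit X := by
    rw [← linearIndependent_cols_iff_isUnit]
    exact (linearIndependent_monoidHom G ℂ).comp χ hχ
  -- One copy of `X` for each index in `n`. With `M` the invariant matrix and `D` the block diagonal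
  -- one, the claim becomes `M Y = Y D`.
  set Y : Matrix (n × G) (n × G) ℂ := (blockDiagonal fun _ : n => X).submatrix
    (Equiv.prodComm n G) (Equiv.prodComm n G) with hY
  have hYdet : IsUnit Y.det := by
    rw [hY, det_submatrix_equiv_self, det_blockDiagonal]
    simpa using ((isUnit_iff_isUnit_det _).1 hXu).pow _
  rw [← det_blockDiagonal, ← hYdet.mul_left_inj, mul_comm (det (blockDiagonal _)) Y.det, ← det_mul,
    ← det_mul]
  congr 1
  ext ⟨u, g⟩ ⟨v, i⟩
  simp only [mul_apply, Fintype.sum_prod_type, hY, hX, submatrix_apply, of_apply,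
    Equiv.prodComm_apply, Prod.swap_prod_mk, blockDiagonal_apply, mul_ite, ite_mul, mul_zero,
    zero_mul, Finset.sum_ite_irrel, Finset.sum_const_zero, Finset.sum_ite_eq, Finset.sum_ite_eq',
    Finset.mem_univ, if_true]
  -- Substituting `h = g k` makes the entry of `B` depend on `k` only, and `χ i (g k) = χ i g * χ i
  -- k` pulls out the entry of `Y`.
  rw [← Equiv.sum_comp (Equiv.mulLeft g)]
  simp [Finset.mul_sum]
  exact Finset.sum_congr rfl fun _ _ => by ring

end Matrix

/-! ### The Laplacian and the Jacobian of a connected graph -/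

namespace OrientedGraph

variable {V E : Type*} (Γ : OrientedGraph V E)

theorem src_inv (e : E) : Γ.src (Γ.inv e) = Γ.tgt e := rfl

theorem tgt_inv (e : E) : Γ.tgt (Γ.inv e) = Γ.src e := by rw [tgt, Γ.inv_inv]

/-- Reversal of orientation, as a permutation of the oriented edges. -/
def invEquiv : Equiv.Perm E := ⟨Γ.inv, Γ.inv, Γ.inv_inv, Γ.inv_inv⟩

theorem invEquiv_apply (e : E) : Γ.invEquiv e = Γ.inv e := rfl

theorem eq_of_connected {Γ : OrientedGraph V E} (h : Γ.Connected) {α : Type*} {x : V → α}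
    (hx : ∀ e, x (Γ.src e) = x (Γ.tgt e)) (u v : V) : x u = x v := by
  induction h.2 u v with
  | refl => rfl
  | tail _ h ih => obtain ⟨e, rfl, rfl⟩ := h; rw [ih, hx]

variable [Fintype V] [DecidableEq V] [Fintype E]

/-- The Laplacian matrix `Q - A`. -/
def laplacianMatrix (R : Type*) [Ring R] : Matrix V V R :=
  Γ.valencyMatrix R - Γ.adjacencyMatrix R

variable {R : Type*} [CommRing R]

theorem laplacianMatrix_mulVec (x : V → R) (u : V) :
    (Γ.laplacianMatrix R).mulVec x u
      = ∑ e, if Γ.src e = u then x (Γ.src e) - x (Γ.tgt e) else 0 := by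
  have h1 : (Γ.valencyMatrix R).mulVec x u = ∑ e, if Γ.src e = u then x (Γ.src e) else 0 := by
    rw [valencyMatrix, Matrix.mulVec_diagonal, valency, Finset.card_eq_sum_ones, Nat.cast_sum,
      Finset.sum_filter, Finset.sum_mul]
    exact Finset.sum_congr rfl fun e _ => by split_ifs with h <;> simp [h]
  have h2 : (Γ.adjacencyMatrix R).mulVec x u = ∑ e, if Γ.src e = u then x (Γ.tgt e) else 0 := by
    simp only [Matrix.mulVec, dotProduct, adjacencyMatrix, Matrix.of_apply,
      Finset.card_eq_sum_ones, Nat.cast_sum, Finset.sum_filter, Finset.sum_mul]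
    rw [Finset.sum_comm]
    refine Finset.sum_congr rfl fun e _ => ?_
    split_ifs with h <;> simp [h]
  rw [laplacianMatrix, Matrix.sub_mulVec, Pi.sub_apply, h1, h2, ← Finset.sum_sub_distrib]
  exact Finset.sum_congr rfl fun e _ => by split_ifs <;> simp

omit [Fintype V] in
theorem laplacianMatrix_transpose :
    (Γ.laplacianMatrix R).transpose = Γ.laplacianMatrix R := by
  rw [laplacianMatrix, Matrix.transpose_sub, valencyMatrix, Matrix.diagonal_transpose]
  congr 1
  ext u v
  simp only [adjacencyMatrix, Matrix.transpose_apply, Matrix.of_apply]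
  congr 1
  refine Finset.card_bij (fun e _ => Γ.inv e) ?_ ?_ ?_
  · intro e; simp [src_inv, tgt_inv, and_comm]
  · intro e _ f _ h; exact Γ.invEquiv.injective h
  · intro e; simp only [Finset.mem_filter, Finset.mem_univ, true_and]
    exact fun h => ⟨Γ.inv e, by simp [src_inv, tgt_inv, h], Γ.inv_inv e⟩

theorem laplacianMatrix_mulVec_one : (Γ.laplacianMatrix R).mulVec 1 = 0 := by
  ext u; simp [laplacianMatrix_mulVec]

theorem one_vecMul_laplacianMatrix : Matrix.vecMul 1 (Γ.laplacianMatrix R) = 0 := by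
  rw [← laplacianMatrix_transpose, Matrix.vecMul_transpose, laplacianMatrix_mulVec_one]

theorem sum_laplacianMatrix_mulVec (x : V → R) : ∑ u, (Γ.laplacianMatrix R).mulVec x u = 0 := by
  rw [← one_dotProduct, Matrix.dotProduct_mulVec, one_vecMul_laplacianMatrix, zero_dotProduct]

/-- The Dirichlet form: each unoriented edge is counted in both orientations, and averaging over
reversal produces the squares. -/
theorem two_mul_dotProduct_laplacianMatrix (x : V → R) :
    2 * x ⬝ᵥ (Γ.laplacianMatrix R).mulVec x = ∑ e, (x (Γ.src e) - x (Γ.tgt e)) ^ 2 := by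
  have h : x ⬝ᵥ (Γ.laplacianMatrix R).mulVec x
      = ∑ e, x (Γ.src e) * (x (Γ.src e) - x (Γ.tgt e)) := by
    simp only [dotProduct, laplacianMatrix_mulVec, Finset.mul_sum]
    rw [Finset.sum_comm]
    exact Finset.sum_congr rfl fun e _ => by simp
  have h' := h
  rw [← Equiv.sum_comp Γ.invEquiv] at h'
  simp only [invEquiv_apply, src_inv, tgt_inv] at h'
  rw [two_mul]
  nth_rw 1 [h]
  rw [h', ← Finset.sum_add_distrib]
  exact Finset.sum_congr rfl fun e _ => by ring

/-- The Laplacian with `1` added to the diagonal entry of the vertex `w`. -/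
def pinnedLaplacian (R : Type*) [CommRing R] (w : V) : Matrix V V R :=
  Γ.laplacianMatrix R + Matrix.vecMulVec (Pi.single w 1) (Pi.single w 1)

theorem pinnedLaplacian_mulVec (w : V) (x : V → R) :
    (Γ.pinnedLaplacian R w).mulVec x = (Γ.laplacianMatrix R).mulVec x + Pi.single w (x w) := by
  rw [pinnedLaplacian, Matrix.add_mulVec, Matrix.vecMulVec_mulVec]
  ext
  simp [Pi.single_apply]

omit [Fintype V] in
theorem laplacianMatrix_map {S : Type*} [CommRing S] (f : R →+* S) :
    (Γ.laplacianMatrix R).map f = Γ.laplacianMatrix S := by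
  ext u v
  simp [laplacianMatrix, valencyMatrix, adjacencyMatrix, Matrix.diagonal_apply, apply_ite f]

theorem det_pinnedLaplacian_map {S : Type*} [CommRing S] (f : R →+* S) (w : V) :
    f (Γ.pinnedLaplacian R w).det = (Γ.pinnedLaplacian S w).det := by
  rw [RingHom.map_det, RingHom.mapMatrix_apply]
  congr 1
  rw [pinnedLaplacian, pinnedLaplacian, ← Γ.laplacianMatrix_map f]
  ext u v
  simp [Matrix.vecMulVec_apply, Pi.single_apply, apply_ite f]

/-- If the Dirichlet form vanishes then `x` is constant by connectedness, and the extra term `x w ^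
2` forces that constant to be zero. -/
theorem pinnedLaplacian_posDef {Γ : OrientedGraph V E} (h : Γ.Connected) (w : V) :
    (Γ.pinnedLaplacian ℝ w).PosDef := by
  refine Matrix.PosDef.of_dotProduct_mulVec_pos ?_ fun x hx => ?_
  · rw [Matrix.isHermitian_iff_isSymm, Matrix.IsSymm, pinnedLaplacian, Matrix.transpose_add,
      laplacianMatrix_transpose, Matrix.transpose_vecMulVec]
  · have h2 := Γ.two_mul_dotProduct_laplacianMatrix x
    have h0 : 0 ≤ ∑ e, (x (Γ.src e) - x (Γ.tgt e)) ^ 2 :=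
      Finset.sum_nonneg fun e _ => sq_nonneg _
    have hw : x ⬝ᵥ Pi.single w (x w) = x w ^ 2 := by rw [dotProduct_single]; ring
    rw [star_trivial, pinnedLaplacian_mulVec, dotProduct_add, hw]
    by_contra hneg
    have hs : ∑ e, (x (Γ.src e) - x (Γ.tgt e)) ^ 2 = 0 := by nlinarith [sq_nonneg (x w)]
    have hxw : x w = 0 := by nlinarith [sq_nonneg (x w)]
    rw [Finset.sum_eq_zero_iff_of_nonneg fun e _ => sq_nonneg _] at hs
    refine hx (funext fun v => ?_)
    rw [eq_of_connected h (fun e => sub_eq_zero.1 (pow_eq_zero_iff two_ne_zero |>.1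
      (hs e (Finset.mem_univ e)))) v w, hxw, Pi.zero_apply]

theorem det_pinnedLaplacian_pos {Γ : OrientedGraph V E} (h : Γ.Connected) (w : V) :
    0 < (Γ.pinnedLaplacian ℤ w).det := by
  have := (pinnedLaplacian_posDef h w).det_pos
  rw [← Γ.det_pinnedLaplacian_map (Int.castRingHom ℝ)] at this
  rw [eq_intCast] at this
  exact_mod_cast this

theorem mem_principal {D : V → ℤ} :
    D ∈ Γ.principal ↔ ∃ x, (Γ.laplacianMatrix ℤ).mulVec x = D := Iff.rfl

theorem mem_range_pinnedLaplacian {w : V} {D : V → ℤ} (hD : ∑ v, D v = 0) :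
    D ∈ LinearMap.range (Γ.pinnedLaplacian ℤ w).mulVecLin ↔ D ∈ Γ.principal := by
  rw [mem_principal]
  simp only [LinearMap.mem_range, Matrix.mulVecLin_apply, pinnedLaplacian_mulVec]
  constructor
  · rintro ⟨x, rfl⟩
    -- Laplacian images have degree zero, so the degree of the whole is `x w`, which must vanish.
    refine ⟨x, ?_⟩
    simp only [Pi.add_apply, Finset.sum_add_distrib, sum_laplacianMatrix_mulVec,
      Finset.sum_pi_single', Finset.mem_univ, if_true, zero_add] at hD
    simp [hD]
  · rintro ⟨x, rfl⟩
    -- Subtracting a constant keeps the Laplacian image and makes the value at `w` zero.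
    refine ⟨x - x w • 1, ?_⟩
    rw [Matrix.mulVec_sub, Matrix.mulVec_smul, laplacianMatrix_mulVec_one]
    simp

theorem single_mem_range_pinnedLaplacian (w : V) (c : ℤ) :
    Pi.single w c ∈ LinearMap.range (Γ.pinnedLaplacian ℤ w).mulVecLin := by
  refine ⟨c • 1, ?_⟩
  rw [Matrix.mulVecLin_apply, pinnedLaplacian_mulVec, Matrix.mulVec_smul,
    laplacianMatrix_mulVec_one]
  simp

/-- The Jacobian is the cokernel of the Laplacian with `1` added to a diagonal entry. -/
theorem nonempty_jac_equiv (w : V) :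
    Nonempty (Γ.Jac ≃ (V → ℤ) ⧸ LinearMap.range (Γ.pinnedLaplacian ℤ w).mulVecLin) := by
  let N := LinearMap.range (Γ.pinnedLaplacian ℤ w).mulVecLin
  let f : divZero V →+ (V → ℤ) ⧸ N := N.mkQ.toAddMonoidHom.comp (divZero V).subtype
  have hf : Function.Surjective f := by
    intro q
    obtain ⟨D, rfl⟩ := N.mkQ_surjective q
    -- Moving the total degree off `w` gives degree zero without changing the class, as multiples of
    -- `w` lie in the range.
    refine ⟨⟨D - Pi.single w (∑ v, D v), ?_⟩, ?_⟩
    · change ∑ u, (D - Pi.single w (∑ v, D v) : V → ℤ) u = 0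
      simp
    · refine (Submodule.Quotient.eq N).2 ?_
      simpa using N.neg_mem (Γ.single_mem_range_pinnedLaplacian w (∑ v, D v))
  have hker : Γ.principal.addSubgroupOf (divZero V) = f.ker := by
    ext D
    rw [AddSubgroup.mem_addSubgroupOf, AddMonoidHom.mem_ker,
      ← Γ.mem_range_pinnedLaplacian (w := w) D.2]
    exact (Submodule.Quotient.mk_eq_zero N).symm
  exact ⟨((QuotientAddGroup.quotientAddEquivOfEq hker).trans
    (QuotientAddGroup.quotientKerEquivOfSurjective f hf)).toEquiv⟩

theorem card_jac {Γ : OrientedGraph V E} (h : Γ.Connected) (w : V) :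
    (Nat.card Γ.Jac : ℤ) = (Γ.pinnedLaplacian ℤ w).det := by
  have hpos := det_pinnedLaplacian_pos h w
  rw [Nat.card_congr (Γ.nonempty_jac_equiv w).some,
    Matrix.card_quotient_range_mulVecLin hpos.ne', Int.natCast_natAbs, abs_of_pos hpos]

theorem card_jac_pos {Γ : OrientedGraph V E} (h : Γ.Connected) : 0 < Nat.card Γ.Jac := by
  obtain ⟨w⟩ := h.1
  have := det_pinnedLaplacian_pos h w
  rw [← card_jac h w] at this
  exact_mod_cast this

theorem finite_jac {Γ : OrientedGraph V E} (h : Γ.Connected) : Finite Γ.Jac :=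
  Nat.finite_of_card_ne_zero (card_jac_pos h).ne'

/-- The order of the Jacobian from the determinant of the Laplacian with a constant added to all
entries. -/
theorem det_laplacianMatrix_add_const {Γ : OrientedGraph V E} (h : Γ.Connected) (c : R) :
    (Γ.laplacianMatrix R + Matrix.of fun _ _ => c).det
      = c * (Fintype.card V : R) ^ 2 * (Nat.card Γ.Jac : R) := by
  obtain ⟨w⟩ := h.1
  rw [Matrix.det_add_const Γ.one_vecMul_laplacianMatrix Γ.laplacianMatrix_mulVec_one w c,
    ← pinnedLaplacian, ← Γ.det_pinnedLaplacian_map (Int.castRingHom R), ← card_jac h w]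
  simp

end OrientedGraph

/-! ### The Laplacian of a Galois cover and its decomposition by characters -/

namespace FreeGaloisCover

variable {G : Type*} [Group G] {Vt Et V E : Type*} [MulAction G Vt] [MulAction G Et]
  {Γt : OrientedGraph Vt Et} {Γ : OrientedGraph V E}

theorem map_tgt (φ : FreeGaloisCover G Γt Γ) (f : Et) :
    φ.mapV (Γt.tgt f) = Γ.tgt (φ.mapE f) := by
  rw [OrientedGraph.tgt, OrientedGraph.tgt, φ.map_src, φ.map_inv]

theorem smul_tgt (φ : FreeGaloisCover G Γt Γ) (g : G) (f : Et) :
    Γt.tgt (g • f) = g • Γt.tgt f := by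
  rw [OrientedGraph.tgt, OrientedGraph.tgt, φ.smul_inv, φ.smul_src]

theorem connected_base (φ : FreeGaloisCover G Γt Γ) (h : Γt.Connected) : Γ.Connected := by
  refine ⟨h.1.map φ.mapV, fun u v => ?_⟩
  obtain ⟨x, rfl⟩ := φ.surjective u
  obtain ⟨y, rfl⟩ := φ.surjective v
  refine (h.2 x y).lift φ.mapV ?_
  rintro _ _ ⟨f, rfl, rfl⟩
  exact ⟨φ.mapE f, (φ.map_src f).symm, (φ.map_tgt f).symm⟩

theorem eq_of_src_of_mapE (φ : FreeGaloisCover G Γt Γ) {f f' : Et} (h : Γt.src f = Γt.src f')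
    (h' : φ.mapE f = φ.mapE f') : f = f' :=
  (φ.lift_unique (Γt.src f') (φ.mapE f') (φ.map_src f').symm).unique ⟨h, h'⟩ ⟨rfl, rfl⟩

variable (φ : FreeGaloisCover G Γt Γ) (σ : φ.VertexLift)

/-- The vertices of the cover are indexed by the vertices of the base and the group. -/
noncomputable def vertexEquiv : V × G ≃ Vt :=
  Equiv.ofBijective (fun p => p.2 • σ.1 p.1) <| by
    constructor
    · rintro ⟨u, g⟩ ⟨v, h⟩ hp
      have huv : u = v := by
        simpa only [φ.mapV_smul, σ.2] using congrArg φ.mapV hp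
      subst huv
      change g • σ.1 u = h • σ.1 u at hp
      have := φ.free (h⁻¹ * g) (σ.1 u) (by rw [mul_smul, hp, inv_smul_smul])
      rw [inv_mul_eq_one.1 this]
    · intro x
      obtain ⟨g, hg⟩ := φ.transitiveV (σ.1 (φ.mapV x)) x (σ.2 _)
      exact ⟨(φ.mapV x, g), hg⟩

theorem vertexEquiv_apply (p : V × G) : φ.vertexEquiv σ p = p.2 • σ.1 p.1 := rfl

theorem mapV_vertexEquiv (p : V × G) : φ.mapV (φ.vertexEquiv σ p) = p.1 := by
  rw [vertexEquiv_apply, φ.mapV_smul, σ.2]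

theorem frobenius_eq {e : E} {f : Et} {g : G} (h₁ : Γt.src f = σ.1 (Γ.src e))
    (h₂ : φ.mapE f = e) (h₃ : Γt.tgt f = g • σ.1 (Γ.tgt e)) : φ.frobenius σ e = g :=
  (φ.existsUnique_frobenius σ e).unique (φ.existsUnique_frobenius σ e).choose_spec.1
    ⟨f, h₁, h₂, h₃⟩

theorem exists_lift_frobenius (e : E) : ∃ f : Et, Γt.src f = σ.1 (Γ.src e) ∧ φ.mapE f = e ∧
    Γt.tgt f = φ.frobenius σ e • σ.1 (Γ.tgt e) :=
  (φ.existsUnique_frobenius σ e).choose_spec.1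

theorem card_vertices (φ : FreeGaloisCover G Γt Γ) (σ : φ.VertexLift) [Fintype Vt] [Fintype V] [Fintype G] :
    Fintype.card Vt = Fintype.card V * Fintype.card G := by
  rw [← Fintype.card_prod, Fintype.card_congr (φ.vertexEquiv σ)]

theorem sum_character_eq_zero [Fintype G] {ρ : G →* ℂˣ} (h : ρ ≠ 1) : ∑ k, (ρ k : ℂ) = 0 :=
  sum_hom_units_eq_zero ((Units.coeHom ℂ).comp ρ) fun h' => h <| by
    ext k
    exact DFunLike.congr_fun h' k

variable [Fintype Et] [DecidableEq Vt] [Fintype E] [DecidableEq V]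

theorem valency_eq (x : Vt) : Γt.valency x = Γ.valency (φ.mapV x) := by
  refine Finset.card_bij (fun f _ => φ.mapE f) ?_ ?_ ?_
  · intro f hf
    simp only [Finset.mem_filter, Finset.mem_univ, true_and] at hf ⊢
    rw [← φ.map_src, hf]
  · intro f hf f' hf' h
    simp only [Finset.mem_filter, Finset.mem_univ, true_and] at hf hf'
    exact φ.eq_of_src_of_mapE (hf.trans hf'.symm) h
  · intro e he
    simp only [Finset.mem_filter, Finset.mem_univ, true_and] at he
    obtain ⟨f, hf, hfe⟩ := (φ.lift_unique x e he).exists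
    exact ⟨f, by simpa using hf, hfe⟩

variable [DecidableEq G]

/-- Translating an edge by `p.2⁻¹` makes it start at a chosen vertex; it then ends at `p.2⁻¹ * q.2`
times the chosen vertex above `q.1`, which determines its Frobenius element. -/
theorem card_edges_eq (p q : V × G) :
    (Finset.univ.filter fun f : Et => Γt.src f = φ.vertexEquiv σ p ∧
        Γt.tgt f = φ.vertexEquiv σ q).card
      = (Finset.univ.filter fun e : E => (Γ.src e = p.1 ∧ Γ.tgt e = q.1) ∧
        φ.frobenius σ e = p.2⁻¹ * q.2).card := by
  obtain ⟨u, g⟩ := p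
  obtain ⟨v, h⟩ := q
  refine Finset.card_bij (fun f _ => φ.mapE f) ?_ ?_ ?_
  · intro f hf
    simp only [Finset.mem_filter, Finset.mem_univ, true_and] at hf ⊢
    have hs : Γ.src (φ.mapE f) = u := by rw [← φ.map_src, hf.1, mapV_vertexEquiv]
    have ht : Γ.tgt (φ.mapE f) = v := by rw [← φ.map_tgt, hf.2, mapV_vertexEquiv]
    refine ⟨⟨hs, ht⟩, φ.frobenius_eq σ (f := g⁻¹ • f) ?_ (φ.mapE_smul _ _) ?_⟩
    · rw [φ.smul_src, hf.1, vertexEquiv_apply, inv_smul_smul, hs]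
    · rw [φ.smul_tgt, hf.2, vertexEquiv_apply, ht, mul_smul]
  · intro f hf f' hf' h
    simp only [Finset.mem_filter, Finset.mem_univ, true_and] at hf hf'
    exact φ.eq_of_src_of_mapE (hf.1.trans hf'.1.symm) h
  · intro e he
    simp only [Finset.mem_filter, Finset.mem_univ, true_and] at he
    obtain ⟨⟨rfl, rfl⟩, hF⟩ := he
    obtain ⟨f, hs, hm, ht⟩ := φ.exists_lift_frobenius σ e
    refine ⟨g • f, ?_, by rw [φ.mapE_smul, hm]⟩
    rw [Finset.mem_filter, vertexEquiv_apply, vertexEquiv_apply, φ.smul_src, φ.smul_tgt, hs, ht, hF, smul_smul, mul_inv_cancel_left]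
    exact ⟨Finset.mem_univ _, rfl, rfl⟩

/-- The Laplacian of the cover, split by Frobenius element: with `m` the number of edges from `u` to
`v` with Frobenius element `k`, this is
`δ(u, v) δ(k, 1) val(u) - m`. -/
noncomputable def equivariantLaplacian (u v : V) (k : G) : ℂ :=
  (if u = v ∧ k = 1 then (Γ.valency u : ℂ) else 0)
    - ((Finset.univ.filter fun e : E => (Γ.src e = u ∧ Γ.tgt e = v) ∧
        φ.frobenius σ e = k).card : ℂ)

/-- The group coordinates enter only through `p.2⁻¹ * q.2`, the form required by
`Matrix.det_of_group_invariant`. -/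
theorem laplacianMatrix_vertexEquiv (p q : V × G) :
    Γt.laplacianMatrix ℂ (φ.vertexEquiv σ p) (φ.vertexEquiv σ q)
      = φ.equivariantLaplacian σ p.1 q.1 (p.2⁻¹ * q.2) := by
  simp only [OrientedGraph.laplacianMatrix, Matrix.sub_apply, OrientedGraph.valencyMatrix,
    OrientedGraph.adjacencyMatrix, Matrix.diagonal_apply, Matrix.of_apply,
    equivariantLaplacian, card_edges_eq, valency_eq φ, mapV_vertexEquiv,
    (φ.vertexEquiv σ).injective.eq_iff, inv_mul_eq_one, Prod.ext_iff]

omit [Fintype Et] [DecidableEq Vt] in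
-- The Fourier transform over `G` regroups the edges from `u` to `v` by their Frobenius elements.
theorem sum_equivariantLaplacian [Fintype G] (ρ : G →* ℂˣ) (u v : V) :
    ∑ k, φ.equivariantLaplacian σ u v k * (ρ k : ℂ) = φ.artinLaplacian σ ρ u v := by
  simp only [equivariantLaplacian, artinLaplacian, artinAdjacency, OrientedGraph.valencyMatrix,
    Matrix.sub_apply, Matrix.diagonal_apply, Matrix.of_apply, sub_mul, Finset.sum_sub_distrib]
  congr 1
  · by_cases h : u = v <;> simp [h]
  · rw [← Finset.sum_fiberwise _ (φ.frobenius σ)]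
    refine Finset.sum_congr rfl fun k _ => ?_
    rw [Finset.filter_filter, Finset.sum_congr rfl (g := fun _ => (ρ k : ℂ))]
    · rw [Finset.sum_const, nsmul_eq_mul]
    · intro e he
      rw [(Finset.mem_filter.1 he).2.2]

omit [DecidableEq G] [Fintype Et] [DecidableEq Vt] in
theorem artinLaplacian_one : φ.artinLaplacian σ 1 = Γ.laplacianMatrix ℂ := by
  ext u v
  simp [artinLaplacian, artinAdjacency, OrientedGraph.laplacianMatrix,
    OrientedGraph.adjacencyMatrix]

variable [Fintype Vt] [Fintype V] [Fintype G]

/-- Adding `1` to all entries of the Laplacian of the cover adds `|G|` to all entries of the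
trivial Artinised Laplacian and leaves the others unchanged. -/
theorem det_laplacianMatrix_add_one_eq_prod (χ : G → (G →* ℂˣ)) (hχ : Function.Injective χ) :
    (Γt.laplacianMatrix ℂ + Matrix.of fun _ _ => 1).det
      = ∏ i, (φ.artinLaplacian σ (χ i) + Matrix.of fun _ _ => ∑ k, (χ i k : ℂ)).det := by
  rw [← Matrix.det_submatrix_equiv_self (φ.vertexEquiv σ)]
  have h := Matrix.det_of_group_invariant
    -- The all-ones matrix is invariant too: it adds `1` for every `k`, so its transform at `χ i` is
    -- the sum of the values of `χ i`.
    (fun u v k => φ.equivariantLaplacian σ u v k + 1)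
    (fun i => (Units.coeHom ℂ).comp (χ i)) fun i j hij => hχ <| by
      ext k
      exact DFunLike.congr_fun hij k
  convert! h using 1
  · congr 1
    ext p q
    simp [laplacianMatrix_vertexEquiv]
  · refine Finset.prod_congr rfl fun i _ => ?_
    congr 1
    ext u v
    simp [add_mul, Finset.sum_add_distrib, sum_equivariantLaplacian]

end FreeGaloisCover

/-! ### The comparison of Jacobians for a `ℤ/3`-cover -/

theorem mainTheorem6 {Vt Et V E : Type*}
    [Fintype Vt] [DecidableEq Vt] [Fintype Et] [Fintype V] [DecidableEq V] [Fintype E]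
    [MulAction (Multiplicative (ZMod 3)) Vt] [MulAction (Multiplicative (ZMod 3)) Et]
    (Γt : OrientedGraph Vt Et) (Γ : OrientedGraph V E)
    (hconn : Γt.Connected)
    (φ : FreeGaloisCover (Multiplicative (ZMod 3)) Γt Γ) (σ : φ.VertexLift)
    (ρ₁ ρ₂ : Multiplicative (ZMod 3) →* ℂˣ) (h₁ : ρ₁ ≠ 1) (h₂ : ρ₂ ≠ 1) (h₁₂ : ρ₁ ≠ ρ₂) :
    Finite Γt.Jac ∧ Finite Γ.Jac ∧
      (Nat.card Γt.Jac : ℂ) / (3 * (Nat.card Γ.Jac : ℂ)) =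
        1 / 9 * ((φ.artinLaplacian σ ρ₁).det * (φ.artinLaplacian σ ρ₂).det) := by
  have hbase := φ.connected_base hconn
  refine ⟨OrientedGraph.finite_jac hconn, OrientedGraph.finite_jac hbase, ?_⟩
  let χ : Fin 3 → (Multiplicative (ZMod 3) →* ℂˣ) := ![1, ρ₁, ρ₂]
  have hχ : Function.Injective χ := by
    intro i j h
    fin_cases i <;> fin_cases j <;> simp_all [χ, eq_comm]
  -- The characters must be indexed by the group; this works because `ZMod 3` unfolds to `Fin 3`.
  have key := φ.det_laplacianMatrix_add_one_eq_prod σ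
    (fun k => χ (Multiplicative.toAdd k)) (hχ.comp Multiplicative.toAdd.injective)
  have hprod : ∀ F : Fin 3 → ℂ,
      ∏ k : Multiplicative (ZMod 3), F (Multiplicative.toAdd k) = F 0 * F 1 * F 2 := fun F =>
    (Equiv.prod_comp Multiplicative.toAdd F).trans (Fin.prod_univ_three F)
  replace key := key.trans (hprod fun i => (φ.artinLaplacian σ (χ i)
    + Matrix.of fun _ _ => ∑ k, (χ i k : ℂ)).det)
  have hzero : (Matrix.of fun _ _ => (0 : ℂ) : Matrix V V ℂ) = 0 := rfl
  have hcard : (∑ k : Multiplicative (ZMod 3), (((1 : Multiplicative (ZMod 3) →* ℂˣ) k : ℂˣ) : ℂ))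
      = 3 := by simp
  simp only [χ, Matrix.cons_val_zero, Matrix.cons_val_one, Matrix.cons_val,
    FreeGaloisCover.sum_character_eq_zero h₁, FreeGaloisCover.sum_character_eq_zero h₂, hzero,
    add_zero, hcard, φ.artinLaplacian_one σ, OrientedGraph.det_laplacianMatrix_add_const hconn,
    OrientedGraph.det_laplacianMatrix_add_const hbase, φ.card_vertices σ,
    Fintype.card_multiplicative, ZMod.card, Nat.cast_mul, Nat.cast_ofNat, one_mul] at key
  have hV : (Fintype.card V : ℂ) ≠ 0 := by
    have := hbase.1
    exact_mod_cast Fintype.card_ne_zero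
  have hJ : (Nat.card Γ.Jac : ℂ) ≠ 0 := by
    exact_mod_cast (OrientedGraph.card_jac_pos hbase).ne'
  have hkey : (Nat.card Γt.Jac : ℂ) * 3 = Nat.card Γ.Jac *
      ((φ.artinLaplacian σ ρ₁).det * (φ.artinLaplacian σ ρ₂).det) := by
    -- `key` has `(3n)²` on the left and `3n²` on the right, where `n = |V|`; cancelling `3n²`
    -- leaves the factor `3`.
    refine mul_left_cancel₀ (mul_ne_zero (three_ne_zero (α := ℂ)) (pow_ne_zero 2 hV)) ?_
    linear_combination key
  field_simp
  linear_combination 3 * hkey
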